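/- Let $d\ge 1$ and let $\mathbb{S}=\{x\in\mathbb{R}^d:\|x\|=1\}$, with $\sigma$ the surface area measure on $\mathbb{S}$ normalised so that $\sigma(\mathbb{S})=1$. For $k\ge 0$ let $$Q_k=Q_k^{(d)}:=C_k^{(d/2)}-C_{k-2}^{(d/2)},\qquad C_m^{(\lambda)}(x)=\sum_{0\le j\le m/2}(-1)^j\frac{(\lambda)_{m-j}}{j!\,(m-2j)!}(2x)^{m-2j}\quad(m\ge 0),$$ where $C_m^{(\lambda)}:=0$ for $m<0$ and $(\lambda)_m=\lambda(\lambda+1)\cdots(\lambda+m-1)$; that is, for $d\ge2$, the $Q_k$ are the orthogonal polynomials for the weight $(1-x^2)^{(d-3)/2}$ on $[-1,1]$, normalised so that $Q_k(1)$ is the dimension of the space of homogeneous harmonic polynomials of degree $k$ on $\mathbb{R}^d$. Let $\mathrm{Harm}_k(\mathbb{S})$ be the space of restrictions to $\mathbb{S}$ of the homogeneous harmonic polynomials of degree $k$ on $\mathbb{R}^d$ and, for $L\subset\{0,1,2,\ldots\}$, let $P_L=\bigoplus_{k\in L}\mathrm{Harm}_k(\mathbb{S})$. For a finite set $X\subset\mathbb{S}$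 of $n$ unit vectors, write $\mathrm{Ang}(X)=\{\langle v,w\rangle: v,w\in X,\ v\ne w\}$ for its set of angles. $X$ is an $A$-code if $\mathrm{Ang}(X)\subset A$, and it is a spherical $P$-design if $\int_{\mathbb{S}}p\,d\sigma=\frac1n\sum_{v\in X}p(v)$ for all $p\in P$. **Theorem (Upper bound).** Let $F=\sum_k f_kQ_k$ (a finite sum) be a polynomial with $f_k\ge 0$ for all $k$ and $f_0>0$, and let $A\subset[-1,1)$ be such that $F(\alpha)\le 0$ for all $\alpha\in A$. Then the size $n$ of any $A$-code $X\subset\mathbb{S}$ satisfies $$n\le\frac{F(1)}{f_0},$$ with equality if and only if every angle of $X$ is a root of $F$ and $X$ is a spherical $P_L$-design for $L=\{k: f_k>0\}$. -/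

import Mathlib

open MeasureTheory
open scoped Polynomial

noncomputable section

namespace SphericalCodes

/-- The Gegenbauer (ultraspherical) polynomial `C_n^(lam)`, by its standard explicit formula
`∑_{j ≤ n/2} (-1)^j (lam)_{n-j} / (j! (n-2j)!) (2x)^{n-2j}`, where `(lam)_m` is the rising
factorial. -/
def gegenbauer (lam : ℝ) (n : ℕ) : ℝ[X] :=
  ∑ j ∈ Finset.range (n / 2 + 1),
    Polynomial.C ((-1) ^ j * (ascPochhammer ℝ (n - j)).eval lam /
      ((j.factorial : ℝ) * ((n - 2 * j).factorial : ℝ))) *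
      (2 * Polynomial.X) ^ (n - 2 * j)

/-- The orthogonal polynomial `Q_k = Q_k^(d) = C_k^(d/2) - C_{k-2}^(d/2)`, with the convention
that `C_m = 0` for `m < 0`. -/
def Q (d k : ℕ) : ℝ[X] :=
  gegenbauer ((d : ℝ) / 2) k - if 2 ≤ k then gegenbauer ((d : ℝ) / 2) (k - 2) else 0

/-- The unit sphere of `ℝ^d`. -/
abbrev Sph (d : ℕ) : Type :=
  Metric.sphere (0 : EuclideanSpace ℝ (Fin d)) 1

/-- Surface area measure on the unit sphere, normalised to have total mass one. -/
def sigma (d : ℕ) : Measure (Sph d) :=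
  ((volume : Measure (EuclideanSpace ℝ (Fin d))).toSphere Set.univ)⁻¹ •
    (volume : Measure (EuclideanSpace ℝ (Fin d))).toSphere

/-- The Laplacian `∑_i ∂_i²` on polynomials in `d` variables. -/
def laplacian (d : ℕ) : MvPolynomial (Fin d) ℝ →ₗ[ℝ] MvPolynomial (Fin d) ℝ :=
  ∑ i : Fin d, (MvPolynomial.pderiv i).toLinearMap ∘ₗ (MvPolynomial.pderiv i).toLinearMap

/-- `Harm_k(ℝ^d)`: the harmonic homogeneous polynomials of degree `k`. -/
def HarmPoly (d k : ℕ) : Submodule ℝ (MvPolynomial (Fin d) ℝ) :=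
  MvPolynomial.homogeneousSubmodule (Fin d) ℝ k ⊓ LinearMap.ker (laplacian d)

/-- Restriction of polynomials to the unit sphere. -/
def restrictSph (d : ℕ) : MvPolynomial (Fin d) ℝ →ₗ[ℝ] (Sph d → ℝ) :=
  LinearMap.pi fun x =>
    (MvPolynomial.aeval (fun i : Fin d => (x : EuclideanSpace ℝ (Fin d)) i)).toLinearMap

/-- `Harm_k(𝕊)`: the surface spherical harmonics of degree `k`. -/
def HarmSph (d k : ℕ) : Submodule ℝ (Sph d → ℝ) :=
  (HarmPoly d k).map (restrictSph d)

/-- `P_L`, the (internal) sum of the spaces `Harm_k(𝕊)` over `k ∈ L`. -/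
def PL (d : ℕ) (L : Set ℕ) : Submodule ℝ (Sph d → ℝ) :=
  ⨆ k ∈ L, HarmSph d k

/-- The finite set `X` of unit vectors is an (unweighted) spherical design for `P`. -/
def IsDesign {d : ℕ} (P : Submodule ℝ (Sph d → ℝ)) (X : Finset (Sph d)) : Prop :=
  ∀ p ∈ P, ∫ x, p x ∂(sigma d) = ∑ v ∈ X, (1 / (X.card : ℝ)) * p v

/-- The angles of `X`: the inner products of distinct elements. -/
def Ang {d : ℕ} (X : Finset (Sph d)) : Set ℝ :=
  {a | ∃ v ∈ X, ∃ w ∈ X, v ≠ w ∧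
    inner ℝ (v : EuclideanSpace ℝ (Fin d)) (w : EuclideanSpace ℝ (Fin d)) = a}

/-- `X` is an `A`-code. -/
def IsCode {d : ℕ} (A : Set ℝ) (X : Finset (Sph d)) : Prop :=
  Ang X ⊆ A

end SphericalCodes

end

namespace SphericalCodes

/-! Evaluate the sum of `F (⟨v, w⟩)` over ordered pairs of points of `X` in two ways. The diagonal
gives `n F(1)` and the other terms are nonpositive; expanding `F` gives `f 0 * n ^ 2` plus multiples
of the pair sums of the `Q d k`, nonnegative by `pairSum_Q_nonneg`. The bound follows, with equality
exactly when both remainders vanish.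

Positivity is algebraic. In the Fischer pairing, multiplication by `X i` is adjoint to `pderiv i`,
so the homogenised `Q_k(⟨w, x⟩)`, which is harmonic, represents evaluation at `w` on `HarmPoly d k`
up to a positive constant (`fischer_zonal`). The pair sum of `Q d k` is then a positive multiple of
the Fischer square of a sum of zonals, and it vanishes iff every harmonic of degree `k` sums to zero
over `X` (`sum_sum_Q_eq_zero_iff`).

For `k ≠ 0` this is the design condition, since such harmonics have spherical mean zero: Gaussian
integration by parts and polar coordinates give `integral_toSphere_harmonic`. -/

open MvPolynomial in
/-- The Fischer (apolar) pairing `∑ m! p_m q_m` of polynomials. -/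
noncomputable def fischer {d : ℕ} (p q : MvPolynomial (Fin d) ℝ) : ℝ :=
  ∑ m ∈ p.support, coeff m p * ((m.prod fun _ n => (n.factorial : ℝ)) * coeff m q)

/-! ### The Fischer pairing and the Laplacian -/

section Fischer

open MvPolynomial

variable {d : ℕ}

theorem fischer_eq_sum_of_subset {p : MvPolynomial (Fin d) ℝ} {s : Finset (Fin d →₀ ℕ)}
    (hs : p.support ⊆ s) (q : MvPolynomial (Fin d) ℝ) :
    fischer p q = ∑ m ∈ s, coeff m p * ((m.prod fun _ n => (n.factorial : ℝ)) * coeff m q) :=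
  Finset.sum_subset hs fun m _ hm => by rw [notMem_support_iff.1 hm, zero_mul]

theorem fischer_monomial (m : Fin d →₀ ℕ) (a : ℝ) (q : MvPolynomial (Fin d) ℝ) :
    fischer (monomial m a) q = a * ((m.prod fun _ n => (n.factorial : ℝ)) * coeff m q) := by
  classical
  rw [fischer_eq_sum_of_subset (s := {m}) support_monomial_subset, Finset.sum_singleton,
    coeff_monomial, if_pos rfl]

theorem fischer_add_left (p p' q : MvPolynomial (Fin d) ℝ) :
    fischer (p + p') q = fischer p q + fischer p' q := by
  classical
  rw [fischer_eq_sum_of_subset (support_add (p := p) (q := p')),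
    fischer_eq_sum_of_subset (p := p) Finset.subset_union_left,
    fischer_eq_sum_of_subset (p := p') Finset.subset_union_right, ← Finset.sum_add_distrib]
  exact Finset.sum_congr rfl fun m _ => by rw [coeff_add, add_mul]

theorem fischer_add_right (p q q' : MvPolynomial (Fin d) ℝ) :
    fischer p (q + q') = fischer p q + fischer p q' := by
  simp only [fischer, coeff_add, mul_add, Finset.sum_add_distrib]

theorem fischer_zero_right (p : MvPolynomial (Fin d) ℝ) : fischer p 0 = 0 := by
  simp [fischer]

theorem fischer_C_mul_left (p q : MvPolynomial (Fin d) ℝ) (a : ℝ) :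
    fischer (C a * p) q = a * fischer p q := by
  induction p using MvPolynomial.induction_on' with
  | monomial m b => rw [C_mul_monomial, fischer_monomial, fischer_monomial, mul_assoc]
  | add p p' h h' => rw [mul_add, fischer_add_left, fischer_add_left, h, h', mul_add]

theorem fischer_sum_left {ι : Type*} (s : Finset ι) (p : ι → MvPolynomial (Fin d) ℝ)
    (q : MvPolynomial (Fin d) ℝ) : fischer (∑ i ∈ s, p i) q = ∑ i ∈ s, fischer (p i) q :=
  map_sum (AddMonoidHom.mk' (fischer · q) (fischer_add_left · · q)) p s

theorem fischer_sum_right {ι : Type*} (s : Finset ι) (p : MvPolynomial (Fin d) ℝ)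
    (q : ι → MvPolynomial (Fin d) ℝ) : fischer p (∑ i ∈ s, q i) = ∑ i ∈ s, fischer p (q i) :=
  map_sum (AddMonoidHom.mk' (fischer p) (fischer_add_right p)) q s

theorem fischer_self_nonneg (p : MvPolynomial (Fin d) ℝ) : 0 ≤ fischer p p := by
  refine Finset.sum_nonneg fun m _ => ?_
  have : 0 ≤ m.prod fun _ n => (n.factorial : ℝ) := Finset.prod_nonneg fun _ _ => by positivity
  nlinarith [mul_nonneg this (mul_self_nonneg (coeff m p))]

theorem eq_zero_of_fischer_self_eq_zero {p : MvPolynomial (Fin d) ℝ} (h : fischer p p = 0) :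
    p = 0 := by
  have hpos : ∀ m : Fin d →₀ ℕ, 0 < m.prod fun _ n => (n.factorial : ℝ) := fun m =>
    Finset.prod_pos fun _ _ => by positivity
  rw [fischer, Finset.sum_eq_zero_iff_of_nonneg] at h
  · ext m
    by_contra hm
    have := h m (mem_support_iff.2 hm)
    simp only [mul_eq_zero, (hpos m).ne', false_or, or_self] at this
    exact hm this
  · intro m _
    nlinarith [mul_nonneg (hpos m).le (mul_self_nonneg (coeff m p))]

/-- Multiplication by a variable is adjoint to the corresponding partial derivative. -/
theorem fischer_X_mul (i : Fin d) (p q : MvPolynomial (Fin d) ℝ) :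
    fischer (X i * p) q = fischer p (pderiv i q) := by
  induction p using MvPolynomial.induction_on' with
  | monomial m b =>
    have key : ((m + Finsupp.single i 1).prod fun _ n => (n.factorial : ℝ))
        = (m i + 1) * m.prod fun _ n => (n.factorial : ℝ) := by
      rw [Finsupp.prod_fintype _ _ (by simp), Finsupp.prod_fintype _ _ (by simp),
        ← Finset.mul_prod_erase _ _ (Finset.mem_univ i),
        ← Finset.mul_prod_erase (a := i) _ (fun j => ((m j).factorial : ℝ)) (Finset.mem_univ i),
        Finset.prod_congr (g := fun j => ((m j).factorial : ℝ)) rfl]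
      · simp [Nat.factorial_succ, mul_assoc]
      · intro j hj
        simp [Finsupp.single_eq_of_ne (Finset.ne_of_mem_erase hj)]
    have hX : X i * monomial m b = monomial (m + Finsupp.single i 1) b := by
      rw [X, monomial_mul, one_mul, add_comm]
    rw [hX, fischer_monomial, fischer_monomial, key, coeff_pderiv]
    ring
  | add p p' h h' => rw [mul_add, fischer_add_left, fischer_add_left, h, h']

/-- The linear form `⟨w, ·⟩` as a polynomial. -/
noncomputable def linForm (w : Fin d → ℝ) : MvPolynomial (Fin d) ℝ := ∑ i, C (w i) * X i

/-- The squared Euclidean norm as a polynomial. -/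
noncomputable def normSq (d : ℕ) : MvPolynomial (Fin d) ℝ := ∑ i, X i ^ 2

theorem laplacian_apply (p : MvPolynomial (Fin d) ℝ) :
    laplacian d p = ∑ i, pderiv i (pderiv i p) := by
  simp [laplacian]

/-- Adjointness applied twice in each variable; it makes multiples of `normSq d` orthogonal to
harmonic polynomials. -/
theorem fischer_normSq_mul (p q : MvPolynomial (Fin d) ℝ) :
    fischer (normSq d * p) q = fischer p (laplacian d q) := by
  rw [normSq, Finset.sum_mul, fischer_sum_left, laplacian_apply, fischer_sum_right]
  exact Finset.sum_congr rfl fun i _ => by rw [pow_two, mul_assoc, fischer_X_mul, fischer_X_mul]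

theorem eval_linForm (w x : Fin d → ℝ) : eval x (linForm w) = ∑ i, w i * x i := by
  simp [linForm]

theorem eval_normSq (x : Fin d → ℝ) : eval x (normSq d) = ∑ i, x i ^ 2 := by
  simp [normSq]

/-- Powers of linear forms reproduce homogeneous polynomials for the Fischer pairing. -/
theorem fischer_linForm_pow (w : Fin d → ℝ) {k : ℕ} {q : MvPolynomial (Fin d) ℝ}
    (hq : q.IsHomogeneous k) : fischer (linForm w ^ k) q = k.factorial * eval w q := by
  induction k generalizing q with
  | zero =>
    obtain ⟨a, rfl⟩ : ∃ a, q = C a := ⟨_, totalDegree_eq_zero_iff_eq_C.1 (by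
      simpa using hq.totalDegree_le)⟩
    have : (linForm w ^ 0 : MvPolynomial (Fin d) ℝ) = monomial 0 1 := by simp
    rw [this, fischer_monomial]
    simp
  | succ k ih =>
    -- One factor of `linForm w` moves across as the derivative along `w`; at the point `w`, Euler's
    -- identity turns this into the factor `k + 1`.
    have euler := congrArg (eval w) hq.sum_X_mul_pderiv
    simp only [map_sum, map_mul, eval_X, nsmul_eq_mul, map_natCast] at euler
    have step : ∀ i, fischer (C (w i) * X i * linForm w ^ k) q
        = w i * (k.factorial * eval w (pderiv i q)) := fun i => by
      rw [mul_assoc, fischer_C_mul_left, fischer_X_mul, ih (by simpa using hq.pderiv (i := i))]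
    rw [pow_succ', linForm, Finset.sum_mul, fischer_sum_left, ← linForm,
      Finset.sum_congr rfl fun i _ => step i, Nat.factorial_succ, Nat.cast_mul]
    calc ∑ i, w i * (k.factorial * eval w (pderiv i q))
        = k.factorial * ∑ i, w i * eval w (pderiv i q) := by
          rw [Finset.mul_sum]; exact Finset.sum_congr rfl fun _ _ => by ring
      _ = _ := by rw [euler]; ring

theorem pderiv_linForm (w : Fin d → ℝ) (i : Fin d) : pderiv i (linForm w) = C (w i) := by
  simp [linForm, pderiv_X, Pi.single_apply]

theorem pderiv_normSq (i : Fin d) : pderiv i (normSq d) = 2 * X i := by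
  simp [normSq, pderiv_X, Pi.single_apply]

theorem laplacian_linForm_pow_mul_normSq_pow {w : Fin d → ℝ} (hw : ∑ i, w i ^ 2 = 1) (m j : ℕ) :
    laplacian d (linForm w ^ m * normSq d ^ j)
      = C ((m : ℝ) * (m - 1)) * (linForm w ^ (m - 2) * normSq d ^ j)
        + C (2 * (j : ℝ) * (2 * m + 2 * j + d - 2)) * (linForm w ^ m * normSq d ^ (j - 1)) := by
  -- In `hj`, `hN` and `hL`, a scalar factor vanishes whenever natural subtraction truncates.
  have hj : ∀ j : ℕ, (j : MvPolynomial (Fin d) ℝ) * ((j - 1 : ℕ) : MvPolynomial (Fin d) ℝ)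
      = j * (j - 1) := fun j => by cases j <;> simp
  have hN : (j : MvPolynomial (Fin d) ℝ) * (j - 1) * normSq d ^ (j - 1 - 1) * normSq d
      = j * (j - 1) * normSq d ^ (j - 1) := by
    rcases j with _ | _ | j
    · simp
    · simp
    · simp [pow_succ, mul_assoc]
  have hL : (m : MvPolynomial (Fin d) ℝ) * linForm w ^ (m - 1) * linForm w = m * linForm w ^ m := by
    rcases m with _ | m
    · simp
    · simp [pow_succ, mul_assoc]
  have term : ∀ i : Fin d, pderiv i (pderiv i (linForm w ^ m * normSq d ^ j))
      = ((m : MvPolynomial (Fin d) ℝ) * ((m : MvPolynomial (Fin d) ℝ) - 1) *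
          linForm w ^ (m - 2) * normSq d ^ j) * C (w i ^ 2)
        + (4 * (m : MvPolynomial (Fin d) ℝ) * (j : MvPolynomial (Fin d) ℝ) *
          linForm w ^ (m - 1) * normSq d ^ (j - 1)) * (C (w i) * X i)
        + (4 * (j : MvPolynomial (Fin d) ℝ) * ((j : MvPolynomial (Fin d) ℝ) - 1) *
          linForm w ^ m * normSq d ^ (j - 1 - 1)) * X i ^ 2
        + 2 * (j : MvPolynomial (Fin d) ℝ) * linForm w ^ m * normSq d ^ (j - 1) := fun i => by
    have h2 : pderiv i (2 : MvPolynomial (Fin d) ℝ) = 0 := by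
      exact pderiv_C (R := ℝ) (a := 2) (i := i)
    have hn : ∀ n : ℕ, pderiv i (n : MvPolynomial (Fin d) ℝ) = 0 := fun n => by
      simp
    simp only [pderiv_mul, pderiv_pow, pderiv_linForm, pderiv_normSq, map_add, pderiv_C,
      pderiv_X_self, h2, hn, Nat.sub_sub, one_add_one_eq_two, C_pow]
    linear_combination (C (w i) ^ 2 * linForm w ^ (m - 2) * normSq d ^ j) * hj m
      + (4 * X i ^ 2 * linForm w ^ m * normSq d ^ (j - 2)) * hj j
  rw [laplacian_apply, Finset.sum_congr rfl fun i _ => term i]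
  simp only [Finset.sum_add_distrib, ← Finset.mul_sum, ← map_sum, hw]
  rw [← linForm, ← normSq]
  simp only [Finset.sum_const, Finset.card_univ, Fintype.card_fin, nsmul_eq_mul, map_mul, map_sub,
    map_add, map_natCast, map_one, map_ofNat]
  linear_combination (4 * linForm w ^ m) * hN + (4 * j * normSq d ^ (j - 1)) * hL

end Fischer

/-! ### Explicit coefficients of `Q_k` -/

/-- The coefficient of `x^(k-2j)` in `C_k^(lam) - C_{k-2}^(lam)`. -/
noncomputable def zonalCoeff (lam : ℝ) (k j : ℕ) : ℝ :=
  (-1) ^ j * 2 ^ (k - 2 * j) *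
    ((ascPochhammer ℝ (k - j)).eval lam + j * (ascPochhammer ℝ (k - 1 - j)).eval lam) /
      (j.factorial * (k - 2 * j).factorial)

theorem zonalCoeff_zero_pos {lam : ℝ} (h : 0 < lam) (k : ℕ) : 0 < zonalCoeff lam k 0 := by
  have := ascPochhammer_pos k lam h
  simp only [zonalCoeff, Nat.cast_zero, zero_mul, add_zero, pow_zero, Nat.sub_zero, mul_zero]
  positivity

theorem gegenbauer_eq_sum (lam : ℝ) (k : ℕ) :
    gegenbauer lam k = ∑ j ∈ Finset.range (k / 2 + 1),
      Polynomial.C ((-1) ^ j * 2 ^ (k - 2 * j) * (ascPochhammer ℝ (k - j)).eval lam /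
        (j.factorial * (k - 2 * j).factorial)) * Polynomial.X ^ (k - 2 * j) := by
  refine Finset.sum_congr rfl fun j _ => ?_
  rw [mul_pow, ← Polynomial.C_ofNat, ← Polynomial.C_pow, ← mul_assoc, ← Polynomial.C_mul]
  congr 2
  ring

theorem Q_eq_sum (d k : ℕ) :
    Q d k = ∑ j ∈ Finset.range (k / 2 + 1),
      Polynomial.C (zonalCoeff (d / 2) k j) * Polynomial.X ^ (k - 2 * j) := by
  rw [Q, gegenbauer_eq_sum]
  split_ifs with h
  · obtain ⟨k, rfl⟩ := Nat.exists_eq_add_of_le' h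
    rw [gegenbauer_eq_sum, Nat.add_sub_cancel, Nat.add_div_right k two_pos,
      Finset.sum_range_succ' _ (k / 2 + 1), Finset.sum_range_succ' _ (k / 2 + 1),
      add_sub_right_comm, ← Finset.sum_sub_distrib]
    congr 1
    · refine Finset.sum_congr rfl fun j _ => ?_
      rw [show k + 2 - 2 * (j + 1) = k - 2 * j by omega, ← sub_mul, ← Polynomial.C_sub, zonalCoeff,
        show k + 2 - 2 * (j + 1) = k - 2 * j by omega, show k + 2 - 1 - (j + 1) = k - j by omega]
      congr 2
      rw [Nat.factorial_succ]
      push_cast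
      field_simp
      ring
    · simp [zonalCoeff]
  · have : k / 2 = 0 := by omega
    simp [this, zonalCoeff]

theorem Q_zero (d : ℕ) : Q d 0 = 1 := by
  simp [Q_eq_sum, zonalCoeff]

/-- With `2 * lam = d`, this is the vanishing of one coefficient in the Laplacian of the zonal
polynomial. -/
theorem zonalCoeff_succ (lam : ℝ) {k j : ℕ} (h : 2 * j + 2 ≤ k) :
    zonalCoeff lam k j * (((k - 2 * j : ℕ) : ℝ) * (((k - 2 * j : ℕ) : ℝ) - 1))
      + zonalCoeff lam k (j + 1) * (2 * ((j + 1 : ℕ) : ℝ) *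
        (2 * ((k - 2 * (j + 1) : ℕ) : ℝ) + 2 * ((j + 1 : ℕ) : ℝ) + 2 * lam - 2)) = 0 := by
  obtain ⟨m, rfl⟩ := Nat.exists_eq_add_of_le' h
  rw [zonalCoeff, zonalCoeff, show m + (2 * j + 2) - 2 * j = m + 2 by omega,
    show m + (2 * j + 2) - 2 * (j + 1) = m by omega,
    show m + (2 * j + 2) - j = m + j + 1 + 1 by omega,
    show m + (2 * j + 2) - 1 - j = m + j + 1 by omega,
    show m + (2 * j + 2) - (j + 1) = m + j + 1 by omega,
    show m + (2 * j + 2) - 1 - (j + 1) = m + j by omega]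
  simp only [ascPochhammer_succ_eval, Nat.factorial_succ]
  push_cast
  field_simp
  ring

/-! ### Zonal harmonics and positive definiteness -/

section Zonal

open MvPolynomial

variable {d : ℕ}

/-- The zonal harmonic of degree `k` with pole `w`: the homogenisation of `Q_k(⟨w, x⟩)`. -/
noncomputable def zonal (k : ℕ) (w : Fin d → ℝ) : MvPolynomial (Fin d) ℝ :=
  ∑ j ∈ Finset.range (k / 2 + 1),
    C (zonalCoeff (d / 2) k j) * (linForm w ^ (k - 2 * j) * normSq d ^ j)

theorem isHomogeneous_zonal (k : ℕ) (w : Fin d → ℝ) : (zonal k w).IsHomogeneous k := by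
  refine IsHomogeneous.sum _ _ _ fun j hj => ?_
  have hu : (linForm w).IsHomogeneous 1 :=
    IsHomogeneous.sum _ _ _ fun i _ => isHomogeneous_C_mul_X _ _
  have hr : (normSq d).IsHomogeneous 2 :=
    IsHomogeneous.sum _ _ _ fun i _ => isHomogeneous_X_pow i 2
  have := (isHomogeneous_C (Fin d) (zonalCoeff (d / 2) k j)).mul
    ((hu.pow (k - 2 * j)).mul (hr.pow j))
  have hk : 0 + (1 * (k - 2 * j) + 2 * j) = k := by
    have := Finset.mem_range.1 hj
    omega
  rwa [hk] at this

/-- Each summand contributes two terms. The first from index `j` cancels the second from `j + 1` by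
`zonalCoeff_succ`; the two unpaired end terms have coefficient zero. -/
theorem laplacian_zonal (k : ℕ) {w : Fin d → ℝ} (hw : ∑ i, w i ^ 2 = 1) :
    laplacian d (zonal k w) = 0 := by
  simp only [zonal, map_sum, ← smul_eq_C_mul, map_smul, laplacian_linForm_pow_mul_normSq_pow hw,
    smul_add, smul_smul, Finset.sum_add_distrib]
  rw [Finset.sum_range_succ, Finset.sum_range_succ' _ (k / 2)]
  have hlast : ((k - 2 * (k / 2) : ℕ) : ℝ) * (((k - 2 * (k / 2) : ℕ) : ℝ) - 1) = 0 := by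
    rcases Nat.mod_two_eq_zero_or_one k with h | h
    · simp [show k - 2 * (k / 2) = 0 by omega]
    · simp [show k - 2 * (k / 2) = 1 by omega]
  rw [hlast]
  simp only [mul_zero, zero_smul, Nat.cast_zero, zero_mul, add_zero]
  rw [← Finset.sum_add_distrib]
  refine Finset.sum_eq_zero fun j hj => ?_
  have hj' : 2 * j + 2 ≤ k := by
    have := Finset.mem_range.1 hj
    omega
  rw [show k - 2 * j - 2 = k - 2 * (j + 1) by omega, Nat.add_sub_cancel, ← add_smul]
  have := zonalCoeff_succ ((d : ℝ) / 2) hj'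
  rw [mul_div_cancel₀ _ (two_ne_zero' ℝ)] at this
  rw [this, zero_smul]

theorem zonal_mem_harmPoly (k : ℕ) {w : Fin d → ℝ} (hw : ∑ i, w i ^ 2 = 1) :
    zonal k w ∈ HarmPoly d k :=
  ⟨isHomogeneous_zonal k w, laplacian_zonal k hw⟩

theorem eval_zonal (k : ℕ) (w : Fin d → ℝ) {x : Fin d → ℝ} (hx : ∑ i, x i ^ 2 = 1) :
    eval x (zonal k w) = (Q d k).eval (∑ i, w i * x i) := by
  simp [zonal, Q_eq_sum, Polynomial.eval_finsetSum, eval_linForm, eval_normSq, hx]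

/-- The reproducing property of zonal harmonics. -/
theorem fischer_zonal (k : ℕ) (w : Fin d → ℝ) {q : MvPolynomial (Fin d) ℝ}
    (hq : q ∈ HarmPoly d k) :
    fischer (zonal k w) q = zonalCoeff (d / 2) k 0 * k.factorial * eval w q := by
  -- Only `j = 0` survives: every other term has a factor `normSq d`, which passes to `q` as the
  -- Laplacian.
  rw [zonal, fischer_sum_left, Finset.sum_range_succ', Finset.sum_eq_zero, zero_add,
    fischer_C_mul_left]
  · simp [fischer_linForm_pow w hq.1, mul_assoc]
  · intro j _
    rw [fischer_C_mul_left, pow_succ', mul_left_comm, fischer_normSq_mul,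
      LinearMap.mem_ker.1 hq.2, fischer_zero_right, mul_zero]

theorem fischer_sum_zonal_self {ι : Type*} (s : Finset ι) (k : ℕ) (v : ι → Fin d → ℝ)
    (hv : ∀ a, ∑ i, v a i ^ 2 = 1) :
    fischer (∑ a ∈ s, zonal k (v a)) (∑ a ∈ s, zonal k (v a)) =
      zonalCoeff (d / 2) k 0 * k.factorial *
        ∑ a ∈ s, ∑ b ∈ s, (Q d k).eval (∑ i, v a i * v b i) := by
  rw [fischer_sum_left, Finset.mul_sum]
  refine Finset.sum_congr rfl fun a _ => ?_
  rw [fischer_sum_right, Finset.mul_sum]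
  refine Finset.sum_congr rfl fun b _ => ?_
  rw [fischer_zonal k _ (zonal_mem_harmPoly k (hv b)), eval_zonal k _ (hv a)]
  simp only [mul_comm (v b _)]

/-- `Q_k` is a positive definite kernel on the sphere. -/
theorem sum_sum_Q_nonneg (hd : 1 ≤ d) {ι : Type*} (s : Finset ι) (k : ℕ) (v : ι → Fin d → ℝ)
    (hv : ∀ a, ∑ i, v a i ^ 2 = 1) :
    0 ≤ ∑ a ∈ s, ∑ b ∈ s, (Q d k).eval (∑ i, v a i * v b i) := by
  have h := fischer_self_nonneg (∑ a ∈ s, zonal k (v a))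
  rw [fischer_sum_zonal_self s k v hv] at h
  have hc := zonalCoeff_zero_pos (lam := (d : ℝ) / 2) (by positivity) k
  exact nonneg_of_mul_nonneg_right h (by positivity)

/-- A vanishing double sum forces the sum of zonals to be zero by definiteness, and pairing it with
`q` yields the point sum. Conversely, the zonals themselves serve as test harmonics. -/
theorem sum_sum_Q_eq_zero_iff (hd : 1 ≤ d) {ι : Type*} (s : Finset ι) (k : ℕ)
    (v : ι → Fin d → ℝ) (hv : ∀ a, ∑ i, v a i ^ 2 = 1) :
    ∑ a ∈ s, ∑ b ∈ s, (Q d k).eval (∑ i, v a i * v b i) = 0 ↔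
      ∀ q ∈ HarmPoly d k, ∑ a ∈ s, eval (v a) q = 0 := by
  have hc := zonalCoeff_zero_pos (lam := (d : ℝ) / 2) (by positivity) k
  have hc' : zonalCoeff ((d : ℝ) / 2) k 0 * k.factorial ≠ 0 := by positivity
  constructor
  · intro h q hq
    have h0 : ∑ a ∈ s, zonal k (v a) = 0 := eq_zero_of_fischer_self_eq_zero (by
      rw [fischer_sum_zonal_self s k v hv, h, mul_zero])
    have h1 := fischer_sum_left s (fun a => zonal k (v a)) q
    simp only [h0, fischer_zonal k _ hq, ← Finset.mul_sum] at h1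
    rw [show fischer 0 q = 0 by simp [fischer]] at h1
    exact (mul_eq_zero.1 h1.symm).resolve_left hc'
  · intro h
    refine Finset.sum_eq_zero fun a _ => ?_
    rw [← h _ (zonal_mem_harmPoly k (hv a))]
    exact Finset.sum_congr rfl fun b _ => (eval_zonal k _ (hv b)).symm

end Zonal

/-! ### Spherical means of harmonic polynomials -/

section SphereIntegral

open MvPolynomial

variable {d : ℕ}

theorem eval_mul_of_isHomogeneous {k : ℕ} {p : MvPolynomial (Fin d) ℝ} (hp : p.IsHomogeneous k)
    (r : ℝ) (x : Fin d → ℝ) : eval (fun i => r * x i) p = r ^ k * eval x p := by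
  rw [eval_eq', eval_eq', Finset.mul_sum]
  refine Finset.sum_congr rfl fun m hm => ?_
  have hk : ∑ i, m i = k := by
    rw [← Finsupp.degree_eq_sum, Finsupp.degree_eq_weight_one]
    exact hp (mem_support_iff.1 hm)
  simp only [mul_pow, Finset.prod_mul_distrib, Finset.prod_pow_eq_pow_sum, hk]
  ring

theorem continuous_eval_euclidean (p : MvPolynomial (Fin d) ℝ) :
    Continuous fun x : EuclideanSpace ℝ (Fin d) => eval (fun i => x i) p :=
  p.continuous_eval.comp (by fun_prop)

theorem hasLineDerivAt_eval (p : MvPolynomial (Fin d) ℝ) (x : EuclideanSpace ℝ (Fin d))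
    (i : Fin d) :
    HasLineDerivAt ℝ (fun x : EuclideanSpace ℝ (Fin d) => eval (fun i => x i) p)
      (eval (fun i => x i) (pderiv i p)) x (EuclideanSpace.single i 1) := by
  unfold HasLineDerivAt
  induction p using MvPolynomial.induction_on with
  | C a => simpa using hasDerivAt_const (0 : ℝ) a
  | add p q hp hq => simpa only [map_add] using HasDerivAt.fun_add hp hq
  | mul_X p j hp =>
    have hX : HasDerivAt
        (fun t : ℝ => (x + t • EuclideanSpace.single i (1 : ℝ) : EuclideanSpace ℝ (Fin d)) j)
        (if j = i then 1 else 0) 0 := by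
      have := ((hasDerivAt_id (0 : ℝ)).mul_const (if j = i then (1 : ℝ) else 0)).const_add (x j)
      simpa using this
    have := HasDerivAt.fun_mul hp hX
    simp only [zero_smul, add_zero] at this
    have e : eval (fun i => x i) (pderiv i (p * X j))
        = eval (fun i => x i) (pderiv i p) * x j
          + eval (fun i => x i) p * (if j = i then 1 else 0) := by
      by_cases h : j = i
      · subst h
        simp [mul_comm, add_comm]
      · simp [pderiv_X_of_ne h, h, mul_comm]
    simp only [map_mul, eval_X]
    rw [e]
    exact this

/-- The Gaussian weight `exp (-‖x‖²)`. -/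
noncomputable def gauss (x : EuclideanSpace ℝ (Fin d)) : ℝ := Real.exp (-‖x‖ ^ 2)

theorem continuous_gauss : Continuous (gauss (d := d)) := by
  unfold gauss
  fun_prop

theorem hasLineDerivAt_gauss (x : EuclideanSpace ℝ (Fin d)) (i : Fin d) :
    HasLineDerivAt ℝ gauss (-(2 * x i) * gauss x) x (EuclideanSpace.single i 1) := by
  have h := (((hasStrictFDerivAt_norm_sq x).hasFDerivAt.neg).exp).hasLineDerivAt
    (EuclideanSpace.single i 1)
  have e : -(2 * x i) * gauss x = (Real.exp ((-fun x => ‖x‖ ^ 2) x) • -(2 • (innerSL ℝ) x))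
      (EuclideanSpace.single i 1) := by
    simp [gauss, EuclideanSpace.inner_single_right]
    ring
  rw [e]
  exact h

theorem integrable_norm_pow_mul_gauss (hd : 1 ≤ d) (n : ℕ) :
    Integrable fun x : EuclideanSpace ℝ (Fin d) => ‖x‖ ^ n * gauss x := by
  have : Nonempty (Fin d) := ⟨⟨0, hd⟩⟩
  refine (integrable_fun_norm_addHaar (f := fun r : ℝ => r ^ n * Real.exp (-r ^ 2)) volume).2 ?_
  have := integrableOn_rpow_mul_exp_neg_mul_sq one_pos
    (s := ((Module.finrank ℝ (EuclideanSpace ℝ (Fin d)) - 1 + n : ℕ) : ℝ))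
    (by linarith [(Nat.cast_nonneg (Module.finrank ℝ (EuclideanSpace ℝ (Fin d)) - 1 + n) :
      (0 : ℝ) ≤ _)])
  simpa only [Real.rpow_natCast, pow_add, smul_eq_mul, neg_one_mul, mul_assoc] using this

theorem integrable_eval_mul_gauss (hd : 1 ≤ d) (p : MvPolynomial (Fin d) ℝ) :
    Integrable fun x : EuclideanSpace ℝ (Fin d) => eval (fun i => x i) p * gauss x := by
  induction p using MvPolynomial.induction_on' with
  | monomial m a =>
    refine ((integrable_norm_pow_mul_gauss hd (∑ i, m i)).const_mul |a|).mono'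
      ((continuous_eval_euclidean _).mul continuous_gauss).aestronglyMeasurable
      (Filter.Eventually.of_forall fun x => ?_)
    rw [eval_monomial, Finsupp.prod_fintype _ _ (by simp), norm_mul, norm_mul, norm_prod,
      Real.norm_eq_abs a, mul_assoc, ← Finset.prod_pow_eq_pow_sum,
      Real.norm_of_nonneg (r := gauss x) (Real.exp_nonneg _)]
    have : 0 ≤ gauss x := Real.exp_nonneg _
    gcongr with i
    rw [norm_pow]
    gcongr
    exact PiLp.norm_apply_le x i
  | add p q hp hq => simpa only [map_add, add_mul] using Integrable.fun_add hp hq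

/-- Gaussian integration by parts. -/
theorem integral_eval_pderiv_mul_gauss (hd : 1 ≤ d) (p : MvPolynomial (Fin d) ℝ) (i : Fin d) :
    ∫ x : EuclideanSpace ℝ (Fin d), eval (fun i => x i) (pderiv i p) * gauss x
      = 2 * ∫ x : EuclideanSpace ℝ (Fin d), eval (fun i => x i) (X i * p) * gauss x := by
  have e : ∀ x : EuclideanSpace ℝ (Fin d), eval (fun i => x i) p * (-(2 * x i) * gauss x)
      = -2 * (eval (fun i => x i) (X i * p) * gauss x) := fun x => by
    rw [map_mul, eval_X]; ring
  have h := integral_bilinear_hasLineDerivAt_right_eq_neg_left_of_integrable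
    (μ := (volume : Measure (EuclideanSpace ℝ (Fin d)))) (B := ContinuousLinearMap.mul ℝ ℝ)
    (f := fun x : EuclideanSpace ℝ (Fin d) => eval (fun i => x i) p)
    (f' := fun x : EuclideanSpace ℝ (Fin d) => eval (fun i => x i) (pderiv i p))
    (g := gauss) (g' := fun x => -(2 * x i) * gauss x) (v := EuclideanSpace.single i 1)
    (integrable_eval_mul_gauss hd _)
    (by simpa only [ContinuousLinearMap.mul_apply', e] using
      (integrable_eval_mul_gauss hd (X i * p)).const_mul (-2))
    (integrable_eval_mul_gauss hd _)
    (fun x _ => hasLineDerivAt_eval p x i) (fun x _ => hasLineDerivAt_gauss x i)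
  simp only [ContinuousLinearMap.mul_apply', e, integral_const_mul] at h
  linarith

/-- Integrating `laplacian d p = 0` against the Gaussian by parts once leaves `2 ∑ x_i ∂_i p`, which
is `2 k p` by Euler's identity. -/
theorem integral_harmonic_mul_gauss (hd : 1 ≤ d) {k : ℕ} (hk : k ≠ 0)
    {p : MvPolynomial (Fin d) ℝ} (hp : p ∈ HarmPoly d k) :
    ∫ x : EuclideanSpace ℝ (Fin d), eval (fun i => x i) p * gauss x = 0 := by
  have sum_int : ∀ q : Fin d → MvPolynomial (Fin d) ℝ,
      ∫ x : EuclideanSpace ℝ (Fin d), eval (fun i => x i) (∑ i, q i) * gauss x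
        = ∑ i, ∫ x : EuclideanSpace ℝ (Fin d), eval (fun i => x i) (q i) * gauss x := fun q => by
    simp only [map_sum, Finset.sum_mul]
    exact integral_finsetSum _ fun i _ => integrable_eval_mul_gauss hd _
  have h := sum_int fun i => pderiv i (pderiv i p)
  rw [← laplacian_apply, LinearMap.mem_ker.1 hp.2,
    Finset.sum_congr rfl fun i _ => integral_eval_pderiv_mul_gauss hd (pderiv i p) i,
    ← Finset.mul_sum, ← sum_int, IsHomogeneous.sum_X_mul_pderiv hp.1] at h
  simp only [map_zero, zero_mul, integral_zero, nsmul_eq_mul, map_mul, map_natCast, mul_assoc,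
    integral_const_mul] at h
  simpa [hk] using h.symm

/-- Integration in polar coordinates of a product of a radial and an angular function. -/
theorem integral_eq_toSphere_mul_radial {f : EuclideanSpace ℝ (Fin d) → ℝ} {h : Sph d → ℝ}
    {g : Set.Ioi (0 : ℝ) → ℝ} (hd : 1 ≤ d)
    (hf : ∀ (r : Set.Ioi (0 : ℝ)) (s : Sph d),
      f ((r : ℝ) • (s : EuclideanSpace ℝ (Fin d))) = h s * g r) :
    ∫ x, f x = (∫ s, h s ∂(volume : Measure (EuclideanSpace ℝ (Fin d))).toSphere) *
      ∫ r, g r ∂(Measure.volumeIoiPow (Module.finrank ℝ (EuclideanSpace ℝ (Fin d)) - 1)) := by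
  have : Nonempty (Fin d) := ⟨⟨0, hd⟩⟩
  have key : ∀ x : ({0}ᶜ : Set (EuclideanSpace ℝ (Fin d))),
      h (homeomorphUnitSphereProd _ x).1 * g (homeomorphUnitSphereProd _ x).2 = f x := fun x => by
    rw [← hf, ← homeomorphUnitSphereProd_symm_apply_coe, Homeomorph.symm_apply_apply]
  calc ∫ x, f x = ∫ x : ({0}ᶜ : Set (EuclideanSpace ℝ (Fin d))), f x
          ∂(volume.comap (Subtype.val : ({0}ᶜ : Set (EuclideanSpace ℝ (Fin d))) → _)) := by
        rw [integral_subtype_comap (measurableSet_singleton _).compl, restrict_compl_singleton]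
    _ = ∫ z : Sph d × Set.Ioi (0 : ℝ), h z.1 * g z.2
          ∂((volume : Measure (EuclideanSpace ℝ (Fin d))).toSphere.prod
            (.volumeIoiPow (Module.finrank ℝ (EuclideanSpace ℝ (Fin d)) - 1))) := by
        rw [← Measure.measurePreserving_homeomorphUnitSphereProd _ |>.integral_comp
          (Homeomorph.measurableEmbedding _)]
        simp only [key]
    _ = _ := integral_prod_mul _ _

theorem integral_toSphere_harmonic (hd : 1 ≤ d) {k : ℕ} (hk : k ≠ 0)
    {p : MvPolynomial (Fin d) ℝ} (hp : p ∈ HarmPoly d k) :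
    ∫ s : Sph d, eval (fun i => (s : EuclideanSpace ℝ (Fin d)) i) p
      ∂(volume : Measure (EuclideanSpace ℝ (Fin d))).toSphere = 0 := by
  have hnorm : ∀ (r : Set.Ioi (0 : ℝ)) (s : Sph d),
      ‖(r : ℝ) • (s : EuclideanSpace ℝ (Fin d))‖ = r := fun r s => by
    rw [norm_smul, norm_eq_of_mem_sphere s, mul_one, Real.norm_of_nonneg r.2.out.le]
  have h₁ := integral_eq_toSphere_mul_radial hd
    (f := fun x => eval (fun i => x i) p * gauss x)
    (h := fun s => eval (fun i => (s : EuclideanSpace ℝ (Fin d)) i) p)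
    (g := fun r => (r : ℝ) ^ k * Real.exp (-(r : ℝ) ^ 2)) fun r s => by
      simp only [gauss, hnorm, PiLp.smul_apply, smul_eq_mul, eval_mul_of_isHomogeneous hp.1]
      ring
  have h₂ := integral_eq_toSphere_mul_radial (d := d) hd
    (f := fun x => ‖x‖ ^ k * gauss x) (h := fun _ => 1)
    (g := fun r => (r : ℝ) ^ k * Real.exp (-(r : ℝ) ^ 2)) fun r s => by
      simp only [gauss, hnorm, one_mul]
  -- This comparison integral has the same radial factor as that of `p`, so the factor is nonzero
  -- and can be cancelled.
  have hpos : 0 < ∫ x : EuclideanSpace ℝ (Fin d), ‖x‖ ^ k * gauss x := by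
    refine integral_pos_of_integrable_nonneg_nonzero (x := EuclideanSpace.single ⟨0, hd⟩ 1)
      ((continuous_norm.pow k).mul continuous_gauss) (integrable_norm_pow_mul_gauss hd k)
      (fun x => mul_nonneg (by positivity) (Real.exp_nonneg _)) ?_
    simp [gauss]
  rw [integral_harmonic_mul_gauss hd hk hp] at h₁
  rw [h₂] at hpos
  exact (mul_eq_zero.1 h₁.symm).resolve_right (right_ne_zero_of_mul hpos.ne')

theorem isProbabilityMeasure_sigma (hd : 1 ≤ d) : IsProbabilityMeasure (sigma d) := by
  have : Nonempty (Fin d) := ⟨⟨0, hd⟩⟩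
  refine ⟨?_⟩
  rw [sigma, Measure.smul_apply, smul_eq_mul]
  exact ENNReal.inv_mul_cancel (by
    rw [Ne, Measure.measure_univ_eq_zero]
    exact Measure.toSphere_ne_zero _) (measure_ne_top _ _)

theorem integral_sigma_harmonic (hd : 1 ≤ d) {k : ℕ} (hk : k ≠ 0)
    {p : MvPolynomial (Fin d) ℝ} (hp : p ∈ HarmPoly d k) :
    ∫ s : Sph d, eval (fun i => (s : EuclideanSpace ℝ (Fin d)) i) p ∂sigma d = 0 := by
  rw [sigma, integral_smul_measure, integral_toSphere_harmonic hd hk hp, smul_zero]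

theorem integrable_eval_sigma (hd : 1 ≤ d) (p : MvPolynomial (Fin d) ℝ) :
    Integrable (fun s : Sph d => eval (fun i => (s : EuclideanSpace ℝ (Fin d)) i) p) (sigma d) := by
  have := isProbabilityMeasure_sigma hd
  exact ((continuous_eval_euclidean p).comp continuous_subtype_val).integrable_of_hasCompactSupport
    (HasCompactSupport.of_compactSpace _)

end SphereIntegral

/-! ### Designs in terms of harmonic sums -/

section Design

open MvPolynomial

variable {d : ℕ}

theorem restrictSph_apply (p : MvPolynomial (Fin d) ℝ) (x : Sph d) :
    restrictSph d p x = eval (fun i => (x : EuclideanSpace ℝ (Fin d)) i) p := by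
  simp [restrictSph, MvPolynomial.aeval_eq_eval]

theorem sum_sq_of_mem_sphere (x : Sph d) : ∑ i, (x : EuclideanSpace ℝ (Fin d)) i ^ 2 = 1 := by
  rw [← EuclideanSpace.real_norm_sq_eq, norm_eq_of_mem_sphere, one_pow]

/-- Degree zero contributes only constants, which are averaged correctly iff `X` is nonempty; in
positive degree the integral is zero. -/
theorem isDesign_homogeneous_iff (hd : 1 ≤ d) {L : Set ℕ} (hL : 0 ∈ L) (X : Finset (Sph d)) :
    IsDesign (PL d L) X ↔ X.Nonempty ∧ ∀ k ∈ L, k ≠ 0 → ∀ q ∈ HarmPoly d k,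
      ∑ v ∈ X, eval (fun i => (v : EuclideanSpace ℝ (Fin d)) i) q = 0 := by
  have := isProbabilityMeasure_sigma hd
  have restrict_mem : ∀ k ∈ L, ∀ q ∈ HarmPoly d k, restrictSph d q ∈ PL d L := fun k hk q hq =>
    Submodule.mem_iSup_of_mem k (Submodule.mem_iSup_of_mem hk (Submodule.mem_map_of_mem hq))
  constructor
  · intro h
    have hX : X.Nonempty := by
      rw [Finset.nonempty_iff_ne_empty]
      rintro rfl
      have := h _ (restrict_mem 0 hL 1 ⟨isHomogeneous_one _ _, by
        simp [LinearMap.mem_ker, laplacian_apply]⟩)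
      simp [restrictSph_apply] at this
    refine ⟨hX, fun k hk hk0 q hq => ?_⟩
    have := h _ (restrict_mem k hk q hq)
    simp only [restrictSph_apply] at this
    rw [integral_sigma_harmonic hd hk0 hq, ← Finset.mul_sum] at this
    refine (mul_eq_zero.1 this.symm).resolve_left ?_
    have := hX.card_pos
    positivity
  · rintro ⟨hX, h⟩
    have hcard : (X.card : ℝ) ≠ 0 := by exact_mod_cast hX.card_ne_zero
    -- Integrability is part of the membership condition so that closure under addition can use
    -- additivity of the integral.
    let S : Submodule ℝ (Sph d → ℝ) :=
      { carrier := {p | Integrable p (sigma d) ∧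
          ∫ x, p x ∂sigma d = ∑ v ∈ X, (1 / (X.card : ℝ)) * p v}
        zero_mem' := ⟨integrable_zero _ _ _, by simp⟩
        add_mem' := fun {p q} hp hq => ⟨hp.1.add hq.1, by
          simp only [Pi.add_apply, mul_add, Finset.sum_add_distrib]
          rw [integral_add hp.1 hq.1, hp.2, hq.2]⟩
        smul_mem' := fun c p hp => ⟨hp.1.smul c, by
          simp only [Pi.smul_apply, smul_eq_mul]
          rw [integral_const_mul, hp.2, Finset.mul_sum]
          exact Finset.sum_congr rfl fun _ _ => by ring⟩ }
    have hS : PL d L ≤ S := by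
      refine iSup₂_le fun k hk => Submodule.map_le_iff_le_comap.2 fun q hq => ?_
      refine ⟨(integrable_eval_sigma hd q).congr
        (.of_forall fun x => (restrictSph_apply q x).symm), ?_⟩
      simp only [restrictSph_apply]
      rcases eq_or_ne k 0 with rfl | hk0
      · obtain ⟨a, rfl⟩ : ∃ a, q = C a := ⟨_, totalDegree_eq_zero_iff_eq_C.1 (by
          simpa using IsHomogeneous.totalDegree_le hq.1)⟩
        simp only [eval_C, integral_const, probReal_univ, one_smul, Finset.sum_const, nsmul_eq_mul]
        field_simp
      · rw [integral_sigma_harmonic hd hk0 hq, ← Finset.mul_sum, h k hk hk0 q hq, mul_zero]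
    exact fun p hp => (hS hp).2

end Design

/-! ### Pair sums over a code -/

section Kernel

variable {d : ℕ}

theorem inner_eq_sum (v w : Sph d) :
    inner ℝ (v : EuclideanSpace ℝ (Fin d)) (w : EuclideanSpace ℝ (Fin d))
      = ∑ i, (v : EuclideanSpace ℝ (Fin d)) i * (w : EuclideanSpace ℝ (Fin d)) i := by
  simp [PiLp.inner_apply, mul_comm]

/-- The sum of `F(⟨v, w⟩)` over all ordered pairs of points of `X`. -/
noncomputable def pairSum (X : Finset (Sph d)) (F : ℝ[X]) : ℝ :=
  ∑ v ∈ X, ∑ w ∈ X,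
    F.eval (inner ℝ (v : EuclideanSpace ℝ (Fin d)) (w : EuclideanSpace ℝ (Fin d)))

theorem pairSum_Q_nonneg (hd : 1 ≤ d) (X : Finset (Sph d)) (k : ℕ) : 0 ≤ pairSum X (Q d k) := by
  simpa only [pairSum, inner_eq_sum] using
    sum_sum_Q_nonneg hd X k (fun v i => (v : EuclideanSpace ℝ (Fin d)) i) sum_sq_of_mem_sphere

theorem pairSum_Q_eq_zero_iff (hd : 1 ≤ d) (X : Finset (Sph d)) (k : ℕ) :
    pairSum X (Q d k) = 0 ↔ ∀ q ∈ HarmPoly d k,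
      ∑ v ∈ X, MvPolynomial.eval (fun i => (v : EuclideanSpace ℝ (Fin d)) i) q = 0 := by
  simpa only [pairSum, inner_eq_sum] using
    sum_sum_Q_eq_zero_iff hd X k (fun v i => (v : EuclideanSpace ℝ (Fin d)) i) sum_sq_of_mem_sphere

/-- The pair sum split by the expansion of `F`. -/
theorem pairSum_expansion (X : Finset (Sph d)) (f : ℕ →₀ ℝ) (hf0 : f 0 ≠ 0) :
    pairSum X (∑ k ∈ f.support, Polynomial.C (f k) * Q d k)
      = f 0 * X.card ^ 2 + ∑ k ∈ f.support.erase 0, f k * pairSum X (Q d k) := by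
  have h : pairSum X (∑ k ∈ f.support, Polynomial.C (f k) * Q d k)
      = ∑ k ∈ f.support, f k * pairSum X (Q d k) := by
    simp only [pairSum, Polynomial.eval_finsetSum, Polynomial.eval_mul, Polynomial.eval_C,
      Finset.mul_sum]
    rw [Finset.sum_comm]
    conv_rhs => rw [Finset.sum_comm]
    rw [Finset.sum_comm]
    refine Finset.sum_congr rfl fun v _ => Finset.sum_comm
  rw [h, ← Finset.add_sum_erase _ _ (Finsupp.mem_support_iff.2 hf0)]
  simp [pairSum, Q_zero, pow_two]

/-- The pair sum split into diagonal and off-diagonal terms. -/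
theorem pairSum_eq_diag_add (X : Finset (Sph d)) (F : ℝ[X]) :
    pairSum X F = X.card * F.eval 1 + ∑ z ∈ X.offDiag,
      F.eval (inner ℝ (z.1 : EuclideanSpace ℝ (Fin d)) (z.2 : EuclideanSpace ℝ (Fin d))) := by
  classical
  rw [pairSum, ← Finset.sum_product', ← Finset.diag_union_offDiag,
    Finset.sum_union (Finset.disjoint_diag_offDiag X), Finset.sum_diag]
  congr 1
  simp

end Kernel

end SphericalCodes

/-! ### The linear programming bound -/

theorem mainTheorem9 (d : ℕ) (hd : 1 ≤ d)
    (f : ℕ →₀ ℝ) (hf : ∀ k, 0 ≤ f k) (hf0 : 0 < f 0)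
    (F : ℝ[X]) (hF : F = ∑ k ∈ f.support, Polynomial.C (f k) * SphericalCodes.Q d k)
    (A : Set ℝ) (hA : A ⊆ Set.Ico (-1) 1) (hFA : ∀ α ∈ A, F.eval α ≤ 0)
    (X : Finset (SphericalCodes.Sph d)) (hX : SphericalCodes.IsCode A X) :
    (X.card : ℝ) ≤ F.eval 1 / f 0 ∧
      ((X.card : ℝ) = F.eval 1 / f 0 ↔
        (∀ α ∈ SphericalCodes.Ang X, F.IsRoot α) ∧
          SphericalCodes.IsDesign (SphericalCodes.PL d {k | 0 < f k}) X) := by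
  open SphericalCodes in
  have hT : ∀ Y : Finset (Sph d), ∀ k ∈ f.support.erase 0, 0 ≤ f k * pairSum Y (Q d k) :=
    fun Y k _ => mul_nonneg (hf k) (pairSum_Q_nonneg hd Y k)
  have split : ∀ Y : Finset (Sph d), Y.card * F.eval 1 + ∑ z ∈ Y.offDiag, F.eval
      (inner ℝ (z.1 : EuclideanSpace ℝ (Fin d)) (z.2 : EuclideanSpace ℝ (Fin d)))
      = f 0 * Y.card ^ 2 + ∑ k ∈ f.support.erase 0, f k * pairSum Y (Q d k) := fun Y => by
    rw [← pairSum_eq_diag_add, hF, pairSum_expansion Y f hf0.ne']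
  -- A one-point set has no off-diagonal pairs, so `split` gives `F(1) ≥ f 0`.
  have hF1 : 0 < F.eval 1 := by
    let x : Sph d := ⟨EuclideanSpace.single ⟨0, hd⟩ 1, by simp⟩
    have h := split {x}
    simp only [Finset.card_singleton, Finset.offDiag_singleton, Finset.sum_empty] at h
    have := Finset.sum_nonneg (hT {x})
    simp only [Nat.cast_one] at h
    linarith
  have hoff : ∀ z ∈ X.offDiag, F.eval
      (inner ℝ (z.1 : EuclideanSpace ℝ (Fin d)) (z.2 : EuclideanSpace ℝ (Fin d))) ≤ 0 :=
    fun z hz => by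
      obtain ⟨h1, h2, h3⟩ := Finset.mem_offDiag.1 hz
      exact hFA _ (hX ⟨z.1, h1, z.2, h2, h3, rfl⟩)
  have hoff_zero : ∑ z ∈ X.offDiag, F.eval
      (inner ℝ (z.1 : EuclideanSpace ℝ (Fin d)) (z.2 : EuclideanSpace ℝ (Fin d))) = 0 ↔
      ∀ α ∈ Ang X, F.IsRoot α := by
    rw [Finset.sum_eq_zero_iff_of_nonpos hoff]
    constructor
    · rintro h α ⟨v, hv, w, hw, hne, rfl⟩
      exact h (v, w) (Finset.mem_offDiag.2 ⟨hv, hw, hne⟩)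
    · intro h z hz
      obtain ⟨h1, h2, h3⟩ := Finset.mem_offDiag.1 hz
      exact h _ ⟨z.1, h1, z.2, h2, h3, rfl⟩
  have hT_zero : ∑ k ∈ f.support.erase 0, f k * pairSum X (Q d k) = 0 ↔
      ∀ k ∈ {k | 0 < f k}, k ≠ 0 → ∀ q ∈ HarmPoly d k,
        ∑ v ∈ X, MvPolynomial.eval (fun i => (v : EuclideanSpace ℝ (Fin d)) i) q = 0 := by
    rw [Finset.sum_eq_zero_iff_of_nonneg (hT X)]
    simp only [← pairSum_Q_eq_zero_iff hd, Finset.mem_erase, Finsupp.mem_support_iff,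
      Set.mem_ofPred_eq, and_imp, mul_eq_zero]
    constructor
    · exact fun h k hk hk0 => (h k hk0 hk.ne').resolve_left hk.ne'
    · exact fun h k hk0 hk => Or.inr (h k ((hf k).lt_of_ne' hk) hk0)
  have hle_off := Finset.sum_nonpos hoff
  have hge_T := Finset.sum_nonneg (hT X)
  have key := split X
  rw [isDesign_homogeneous_iff hd (L := {k | 0 < f k}) hf0, ← hoff_zero, ← hT_zero,
    le_div_iff₀ hf0, eq_div_iff hf0.ne']
  rcases X.eq_empty_or_nonempty with rfl | hne
  -- For empty `X` both sides of the equivalence fail: `F(1) > 0` excludes equality, and a design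
  -- here is nonempty.
  · simp [hF1.le, hF1.ne]
  have hn : (0 : ℝ) < X.card := by exact_mod_cast hne.card_pos
  refine ⟨?_, fun h => ?_, fun h => ?_⟩
  · refine le_of_mul_le_mul_left ?_ hn
    linarith
  -- Equality makes a nonpositive sum equal to a nonnegative one, so both are zero.
  · have : (X.card : ℝ) * F.eval 1 = f 0 * X.card ^ 2 := by rw [← h]; ring
    exact ⟨by linarith, hne, by linarith⟩
  · refine mul_left_cancel₀ hn.ne' ?_
    linarith [h.1, h.2.2]
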